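/- **Borell-TIS inequality for vector-valued processes.** Let $n,k\ge 1$, let $\mathcal T\subset\mathbb R^k$ be compact, and let $\{\mathbf X(t)=(X_1(t),\dots,X_n(t)),\ t\in\mathcal T\}$ be a centered vector-valued Gaussian process whose coordinates $X_1,\dots,X_n$ are mutually independent centered Gaussian processes with a.s. continuous sample paths on $\mathcal T$. Put $\sigma_{X_i}^2(t)=\operatorname{Var}(X_i(t))$ and $$\tau_{\mathcal T}^2=\inf_{t\in\mathcal T}\ \sum_{i=1}^n\frac1{\sigma_{X_i}^2(t)}\in[0,\infty],\qquad \text{where } 1/0=\infty.$$ If $\tau_{\mathcal T}>0$, then there exists a constant $\mu>0$ such that for all $u>\mu$ $$\mathbb P\Big(\exists\, t\in\mathcal T:\ X_i(t)>u\ \text{ for all } 1\le i\le n\Big)\ \le\ \exp\Big(-\frac{(u-\mu)^2}{2}\,\tau_{\mathcal T}^2\Big),$$ where $\exp(-\infty)=0$. -/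

import Mathlib

open MeasureTheory ProbabilityTheory
open scoped ENNReal

/-- A centered `n`-dimensional vector-valued Gaussian process `X(t) = (X₁(t), …, Xₙ(t))`, `t : T`,
on a probability space: the coordinate processes `Xᵢ` are centered Gaussian processes with a.s.
continuous sample paths, and they are mutually independent as random elements of `ℝ^T`. -/
structure IsCenteredVectorGaussianProcess {Ω T : Type*} [MeasurableSpace Ω] [TopologicalSpace T]
    {n : ℕ} (X : T → Ω → Fin n → ℝ) (P : Measure Ω) : Prop where
  measurable : ∀ (t : T) (i : Fin n), Measurable (fun ω => X t ω i)
  isGaussianProcess : ∀ i : Fin n, IsGaussianProcess (fun (t : T) (ω : Ω) => X t ω i) P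
  centered : ∀ (t : T) (i : Fin n), ∫ ω, X t ω i ∂P = 0
  iIndepFun_coord : iIndepFun (fun (i : Fin n) (ω : Ω) (t : T) => X t ω i) P
  continuous_paths : ∀ i : Fin n, ∀ᵐ ω ∂P, Continuous (fun t : T => X t ω i)

/-- `τ² = inf_{t ∈ T} ∑ᵢ 1 / Var(Xᵢ(t))`, computed in `[0, ∞]` with `1 / 0 = ∞`
(and infimum `∞` when `T` is empty). -/
noncomputable def tauSq {Ω T : Type*} [MeasurableSpace Ω] {n : ℕ}
    (X : T → Ω → Fin n → ℝ) (P : Measure Ω) : ℝ≥0∞ :=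
  ⨅ t : T, ∑ i : Fin n, (ENNReal.ofReal (variance (fun ω => X t ω i) P))⁻¹

/-!
# A Borell–TIS inequality for vector-valued Gaussian processes

If all coordinates of `X t` exceed `u`, so does every convex combination `Y t = ∑ i, w t i * X t i`.
The weights minimizing the variance of `Y t` are proportional to `1 / Var (X t i)`, and the minimum
is `(∑ i, 1 / Var (X t i))⁻¹ ≤ 1 / τ²` (`exists_weights_sum_sq_mul_le`). The process `Y` is centered
Gaussian. It need not be continuous where several variances vanish, but it is almost surely bounded
by compactness, and continuity of `X` lets the event be tested on a countable dense set of times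
(`IsCenteredVectorGaussianProcess.measure_exists_forall_lt_le`). So a scalar Borell–TIS inequality
over a countable index set suffices, in which the exponent must be sharp but the centering constant
is free (`ProbabilityTheory.IsGaussianProcess.exists_forall_measure_exists_lt_le`). When `τ² = ∞`
the minimal variance is `0` and `Y` vanishes almost surely.

The freedom in the centering constant allows a short route to concentration. For the standard
Gaussian measure `γ` and `0 < s < 1`, the bound
`f x ^ s * g y ^ (1 - s) ≤ K * exp (s (1 - s) ‖x - y‖² / 2)` implies
`(∫ f dγ) ^ s * (∫ g dγ) ^ (1 - s) ≤ K`. On the line this is a Prékopa–Leindler inequality whose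
majorant, a multiple of the Gaussian density, has convex superlevel sets, so that Brunn–Minkowski
reduces to comparing diameters (`Convex.weighted_volume_add_le`); and the property passes to products
(`TwoFunctionInequality.prod`). For sets at distance `d` it gives
`γ A ^ s * γ B ^ (1 - s) ≤ exp (-s (1 - s) d² / 2)`. With `γ A ≥ 1 / 2` and `1 - s` of order `1 / d`,
this is `γ B ≤ exp (-d² / 2 + O(d))`, and the linear term is absorbed by a shift of `d`.
-/

/-! ### Prékopa–Leindler on the line with a quasiconcave majorant -/

lemma ENNReal.rpow_mul_rpow_le_weighted_add {s : ℝ} (hs : 0 < s) (hs1 : s < 1) (a b : ℝ≥0∞) :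
    a ^ s * b ^ (1 - s) ≤ ENNReal.ofReal s * a + ENNReal.ofReal (1 - s) * b := by
  have hpq : (s⁻¹).HolderConjugate (1 - s)⁻¹ := by
    rw [Real.holderConjugate_iff]
    exact ⟨(one_lt_inv₀ hs).2 hs1, by simp⟩
  have h := ENNReal.young_inequality (a ^ s) (b ^ (1 - s)) hpq
  have hs2 : 0 < 1 - s := by linarith
  rwa [← ENNReal.rpow_mul, ← ENNReal.rpow_mul, mul_inv_cancel₀ hs.ne', mul_inv_cancel₀ hs2.ne',
    ENNReal.rpow_one, ENNReal.rpow_one, ENNReal.ofReal_inv_of_pos hs,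
    ENNReal.ofReal_inv_of_pos hs2, div_eq_mul_inv, div_eq_mul_inv, inv_inv, inv_inv,
    mul_comm a, mul_comm b] at h

lemma lintegral_eq_lintegral_meas_ofReal_lt {α : Type*} [MeasurableSpace α] (μ : Measure α)
    {F : α → ℝ≥0∞} (hF : Measurable F) (hF_top : ∀ x, F x ≠ ∞) :
    ∫⁻ x, F x ∂μ = ∫⁻ t in Set.Ioi (0 : ℝ), μ {x | ENNReal.ofReal t < F x} := by
  have h := lintegral_eq_lintegral_meas_lt μ (f := fun x => (F x).toReal)
    (Filter.Eventually.of_forall fun _ => ENNReal.toReal_nonneg) hF.ennreal_toReal.aemeasurable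
  simp only [ENNReal.ofReal_toReal (hF_top _)] at h
  rw [h]
  refine setLIntegral_congr_fun measurableSet_Ioi fun t ht => ?_
  simp only [ENNReal.ofReal_lt_iff_lt_toReal (le_of_lt ht) (hF_top _)]

lemma lintegral_eq_lintegral_meas_ofReal_le {α : Type*} [MeasurableSpace α] (μ : Measure α)
    {F : α → ℝ≥0∞} (hF : Measurable F) (hF_top : ∀ x, F x ≠ ∞) :
    ∫⁻ x, F x ∂μ = ∫⁻ t in Set.Ioi (0 : ℝ), μ {x | ENNReal.ofReal t ≤ F x} := by
  have h := lintegral_eq_lintegral_meas_le μ (f := fun x => (F x).toReal)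
    (Filter.Eventually.of_forall fun _ => ENNReal.toReal_nonneg) hF.ennreal_toReal.aemeasurable
  simp only [ENNReal.ofReal_toReal (hF_top _)] at h
  rw [h]
  refine setLIntegral_congr_fun measurableSet_Ioi fun t ht => ?_
  simp only [ENNReal.ofReal_le_iff_le_toReal (hF_top _)]

/-- One-dimensional Brunn–Minkowski inequality inside a convex set. Convexity of the target lets the
measures of `A` and `B` be bounded by their diameters, so no compactness argument is needed. -/
lemma Convex.weighted_volume_add_le {s : ℝ} (hs : 0 < s) (hs1 : s < 1) {A B I : Set ℝ}
    (hI : Convex ℝ I) (hA : A.Nonempty) (hB : B.Nonempty)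
    (hABI : ∀ x ∈ A, ∀ y ∈ B, s * x + (1 - s) * y ∈ I) :
    ENNReal.ofReal s * volume A + ENNReal.ofReal (1 - s) * volume B ≤ volume I := by
  have hs2 : 0 < 1 - s := by linarith
  have key : ∀ x ∈ A, ∀ x' ∈ A, ∀ y ∈ B, ∀ y' ∈ B,
      ENNReal.ofReal s * edist x x' + ENNReal.ofReal (1 - s) * edist y y' ≤ volume I := by
    have ordered : ∀ x ∈ A, ∀ x' ∈ A, ∀ y ∈ B, ∀ y' ∈ B, x ≤ x' → y ≤ y' →
        ENNReal.ofReal s * edist x x' + ENNReal.ofReal (1 - s) * edist y y' ≤ volume I := by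
      intro x hx x' hx' y hy y' hy' hxx hyy
      have hsub := hI.ordConnected.out (hABI x hx y hy) (hABI x' hx' y' hy')
      refine le_trans (le_of_eq ?_) (measure_mono hsub)
      rw [Real.volume_Icc, edist_dist, edist_dist, dist_comm, dist_comm y, Real.dist_eq,
        Real.dist_eq, abs_of_nonneg (sub_nonneg.2 hxx), abs_of_nonneg (sub_nonneg.2 hyy),
        ← ENNReal.ofReal_mul hs.le, ← ENNReal.ofReal_mul hs2.le, ← ENNReal.ofReal_add]
      · congr 1; ring
      · exact mul_nonneg hs.le (sub_nonneg.2 hxx)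
      · exact mul_nonneg hs2.le (sub_nonneg.2 hyy)
    intro x hx x' hx' y hy y' hy'
    rcases le_total x x' with h1 | h1 <;> rcases le_total y y' with h2 | h2
    · exact ordered x hx x' hx' y hy y' hy' h1 h2
    · rw [edist_comm y]; exact ordered x hx x' hx' y' hy' y hy h1 h2
    · rw [edist_comm x]; exact ordered x' hx' x hx y hy y' hy' h1 h2
    · rw [edist_comm x, edist_comm y]; exact ordered x' hx' x hx y' hy' y hy h1 h2
  obtain ⟨a, ha⟩ := hA
  obtain ⟨b, hb⟩ := hB
  calc ENNReal.ofReal s * volume A + ENNReal.ofReal (1 - s) * volume B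
      ≤ ENNReal.ofReal s * Metric.ediam A + ENNReal.ofReal (1 - s) * Metric.ediam B := by
        gcongr <;> exact Real.volume_le_diam _
    _ ≤ volume I := by
        simp only [Metric.ediam, ENNReal.mul_iSup]
        refine ENNReal.biSup_add_biSup_le' ⟨a, ha⟩ ⟨b, hb⟩ fun x hx y hy => ?_
        exact ENNReal.biSup_add_biSup_le' ⟨a, ha⟩ ⟨b, hb⟩ fun x' hx' y' hy' =>
          key x hx x' hx' y hy y' hy'

/-- The Prékopa–Leindler inequality on the line with a quasiconcave majorant, for functions
normalized to have supremum `1`. -/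
lemma weighted_lintegral_add_le_of_iSup_eq_one {s : ℝ} (hs : 0 < s) (hs1 : s < 1)
    {F G H : ℝ → ℝ≥0∞} (hF : Measurable F) (hG : Measurable G) (hH : Measurable H)
    (hH_top : ∀ x, H x ≠ ∞) (hH_conv : ∀ c, Convex ℝ {z | c ≤ H z})
    (hF1 : ⨆ x, F x = 1) (hG1 : ⨆ x, G x = 1)
    (h : ∀ x y, F x ^ s * G y ^ (1 - s) ≤ H (s * x + (1 - s) * y)) :
    ENNReal.ofReal s * (∫⁻ x, F x) + ENNReal.ofReal (1 - s) * (∫⁻ x, G x) ≤ ∫⁻ x, H x := by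
  have hs2 : 0 < 1 - s := by linarith
  have hF_le : ∀ x, F x ≤ 1 := fun x => hF1 ▸ le_iSup F x
  have hG_le : ∀ x, G x ≤ 1 := fun x => hG1 ▸ le_iSup G x
  have hF_top : ∀ x, F x ≠ ∞ := fun x => ((hF_le x).trans_lt ENNReal.one_lt_top).ne
  have hG_top : ∀ x, G x ≠ ∞ := fun x => ((hG_le x).trans_lt ENNReal.one_lt_top).ne
  rw [lintegral_eq_lintegral_meas_ofReal_lt _ hF hF_top,
    lintegral_eq_lintegral_meas_ofReal_lt _ hG hG_top,
    lintegral_eq_lintegral_meas_ofReal_le _ hH hH_top,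
    ← lintegral_const_mul' _ _ ENNReal.ofReal_ne_top,
    ← lintegral_const_mul' _ _ ENNReal.ofReal_ne_top, ← lintegral_add_left']
  · refine lintegral_mono fun t => ?_
    by_cases ht : ENNReal.ofReal t < 1
    · refine (hH_conv (ENNReal.ofReal t)).weighted_volume_add_le hs hs1 ?_ ?_ ?_
      · exact lt_iSup_iff.1 (hF1 ▸ ht)
      · exact lt_iSup_iff.1 (hG1 ▸ ht)
      · intro x hx y hy
        refine le_trans ?_ (h x y)
        calc ENNReal.ofReal t = ENNReal.ofReal t ^ s * ENNReal.ofReal t ^ (1 - s) := by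
              rw [← ENNReal.rpow_add_of_nonneg _ _ hs.le hs2.le]; simp
          _ ≤ _ := by
              gcongr
              · exact le_of_lt hx
              · exact le_of_lt hy
    · have e1 : {x | ENNReal.ofReal t < F x} = ∅ := by
        ext x; simpa using (hF_le x).trans (not_lt.1 ht)
      have e2 : {x | ENNReal.ofReal t < G x} = ∅ := by
        ext x; simpa using (hG_le x).trans (not_lt.1 ht)
      simp [e1, e2]
  · refine (Antitone.measurable fun t t' htt => ?_).aemeasurable
    gcongr

/-- The Prékopa–Leindler inequality on the line with a bounded quasiconcave majorant. -/
lemma lintegral_rpow_mul_lintegral_rpow_le_of_quasiconcave {s : ℝ} (hs : 0 < s) (hs1 : s < 1)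
    {F G H : ℝ → ℝ≥0∞} (hF : Measurable F) (hG : Measurable G) (hH : Measurable H)
    {M : ℝ≥0∞} (hM : M ≠ ∞) (hH_le : ∀ x, H x ≤ M) (hH_conv : ∀ c, Convex ℝ {z | c ≤ H z})
    (h : ∀ x y, F x ^ s * G y ^ (1 - s) ≤ H (s * x + (1 - s) * y)) :
    (∫⁻ x, F x) ^ s * (∫⁻ x, G x) ^ (1 - s) ≤ ∫⁻ x, H x := by
  have hs2 : 0 < 1 - s := by linarith
  set a := ⨆ x, F x with ha
  set b := ⨆ x, G x with hb
  by_cases ha0 : a = 0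
  · have : ∀ x, F x = 0 := by simpa [ha] using ha0
    simp [this, hs]
  by_cases hb0 : b = 0
  · have : ∀ x, G x = 0 := by simpa [hb] using hb0
    simp [this, hs1]
  have hprod : a ^ s * b ^ (1 - s) ≤ M := by
    have e1 : a ^ s = ⨆ x, F x ^ s := (ENNReal.orderIsoRpow s hs).map_iSup F
    have e2 : b ^ (1 - s) = ⨆ x, G x ^ (1 - s) := (ENNReal.orderIsoRpow (1 - s) hs2).map_iSup G
    rw [e1, e2, ENNReal.iSup_mul]
    refine iSup_le fun x => ?_
    rw [ENNReal.mul_iSup]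
    exact iSup_le fun y => (h x y).trans (hH_le _)
  have has0 : a ^ s ≠ 0 := by simp [ENNReal.rpow_eq_zero_iff, ha0, hs.not_gt]
  have hbs0 : b ^ (1 - s) ≠ 0 := by simp [ENNReal.rpow_eq_zero_iff, hb0, hs1.le]
  have ha_top : a ≠ ∞ := by
    rintro hat
    rw [hat, ENNReal.top_rpow_of_pos hs, ENNReal.top_mul hbs0] at hprod
    exact hM (top_le_iff.1 hprod)
  have hb_top : b ≠ ∞ := by
    rintro hbt
    rw [hbt, ENNReal.top_rpow_of_pos hs2, ENNReal.mul_top has0] at hprod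
    exact hM (top_le_iff.1 hprod)
  set κ := a ^ s * b ^ (1 - s) with hκ
  have hκ0 : κ ≠ 0 := mul_ne_zero has0 hbs0
  have hκ_top : κ ≠ ∞ := (hprod.trans_lt hM.lt_top).ne
  have hκinv : (a⁻¹) ^ s * (b⁻¹) ^ (1 - s) = κ⁻¹ := by
    rw [ENNReal.inv_rpow, ENNReal.inv_rpow, hκ, ENNReal.mul_inv (Or.inl has0) (Or.inr hbs0)]
  have hnorm := weighted_lintegral_add_le_of_iSup_eq_one hs hs1
    (F := fun x => a⁻¹ * F x) (G := fun x => b⁻¹ * G x) (H := fun x => κ⁻¹ * H x)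
    (hF.const_mul _) (hG.const_mul _) (hH.const_mul _)
    (fun x => ENNReal.mul_ne_top (ENNReal.inv_ne_top.2 hκ0) ((hH_le x).trans_lt hM.lt_top).ne)
    (fun c => by
      have : {z | c ≤ κ⁻¹ * H z} = {z | κ * c ≤ H z} := by
        ext z
        simp only [Set.mem_ofPred_eq]
        rw [mul_comm κ⁻¹, ← div_eq_mul_inv, ENNReal.le_div_iff_mul_le (Or.inl hκ0) (Or.inl hκ_top),
          mul_comm]
      rw [this]; exact hH_conv _)
    (by rw [← ENNReal.mul_iSup, ENNReal.inv_mul_cancel ha0 ha_top])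
    (by rw [← ENNReal.mul_iSup, ENNReal.inv_mul_cancel hb0 hb_top])
    (fun x y => by
      rw [ENNReal.mul_rpow_of_nonneg _ _ hs.le, ENNReal.mul_rpow_of_nonneg _ _ hs2.le,
        mul_mul_mul_comm, hκinv]
      gcongr
      exact h x y)
  have hyoung := (ENNReal.rpow_mul_rpow_le_weighted_add hs hs1 _ _).trans hnorm
  rw [lintegral_const_mul _ hF, lintegral_const_mul _ hG, lintegral_const_mul _ hH,
    ENNReal.mul_rpow_of_nonneg _ _ hs.le, ENNReal.mul_rpow_of_nonneg _ _ hs2.le,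
    mul_mul_mul_comm, hκinv] at hyoung
  exact (ENNReal.mul_le_mul_iff_right (ENNReal.inv_ne_zero.2 hκ_top)
    (ENNReal.inv_ne_top.2 hκ0)).1 hyoung

/-! ### The two-function inequality for Gaussian measures -/

/-- A measure `μ` satisfies the two-function inequality with weight `s` and cost `C` if
`f x ^ s * g y ^ (1 - s) ≤ K * C x y` for all `x, y` forces
`(∫ f dμ) ^ s * (∫ g dμ) ^ (1 - s) ≤ K`. Quantifying over the constant `K` makes the property
stable under products, the costs being multiplied. -/
def TwoFunctionInequality {α : Type*} [MeasurableSpace α] (μ : Measure α) (s : ℝ)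
    (C : α → α → ℝ≥0∞) : Prop :=
  ∀ (K : ℝ≥0∞) (f g : α → ℝ≥0∞), Measurable f → Measurable g →
    (∀ x y, f x ^ s * g y ^ (1 - s) ≤ K * C x y) →
      (∫⁻ x, f x ∂μ) ^ s * (∫⁻ x, g x ∂μ) ^ (1 - s) ≤ K

lemma gaussianPDF_le_of_sq_le {x z : ℝ} (hxz : z ^ 2 ≤ x ^ 2) :
    gaussianPDF 0 1 x ≤ gaussianPDF 0 1 z := by
  refine ENNReal.ofReal_le_ofReal ?_
  simp only [gaussianPDFReal]
  refine mul_le_mul_of_nonneg_left (Real.exp_le_exp.2 ?_) (by positivity)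
  simp only [sub_zero, NNReal.coe_one]
  linarith

lemma convex_setOf_le_const_mul_gaussianPDF (K c : ℝ≥0∞) :
    Convex ℝ {z : ℝ | c ≤ K * gaussianPDF 0 1 z} := by
  rw [convex_iff_ordConnected]
  -- The density is a decreasing function of `|z|`, and `|z| ≤ max |x| |y|` on `[x, y]`.
  refine ⟨fun x hx y hy z hz => ?_⟩
  rcases le_total 0 z with h | h
  · exact le_trans hy (mul_le_mul_right (gaussianPDF_le_of_sq_le (by nlinarith [hz.1, hz.2])) _)
  · exact le_trans hx (mul_le_mul_right (gaussianPDF_le_of_sq_le (by nlinarith [hz.1, hz.2])) _)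

/-- The two-function inequality for the standard Gaussian measure on the line. The Gaussian density
`φ` satisfies `φ x ^ s * φ y ^ (1 - s) = φ (s x + (1 - s) y) * exp (-s (1 - s) (x - y)² / 2)`, so
this is the Prékopa–Leindler inequality for `f φ`, `g φ` and `K φ`. -/
lemma twoFunctionInequality_gaussianReal {s : ℝ} (hs : 0 < s) (hs1 : s < 1) :
    TwoFunctionInequality (gaussianReal 0 1) s
      fun x y => ENNReal.ofReal (Real.exp (s * (1 - s) * (x - y) ^ 2 / 2)) := by
  intro K f g hf hg h
  have hs2 : 0 < 1 - s := by linarith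
  rcases eq_or_ne K ∞ with rfl | hK
  · exact le_top
  have hφ : Measurable (gaussianPDF 0 1) := measurable_gaussianPDF 0 1
  have hφ_mul : ∀ x y, gaussianPDF 0 1 x ^ s * gaussianPDF 0 1 y ^ (1 - s) *
      ENNReal.ofReal (Real.exp (s * (1 - s) * (x - y) ^ 2 / 2)) =
        gaussianPDF 0 1 (s * x + (1 - s) * y) := by
    intro x y
    simp only [gaussianPDF, gaussianPDFReal]
    rw [ENNReal.ofReal_rpow_of_nonneg (by positivity) hs.le,
      ENNReal.ofReal_rpow_of_nonneg (by positivity) hs2.le, ← ENNReal.ofReal_mul (by positivity),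
      ← ENNReal.ofReal_mul (by positivity)]
    congr 1
    set c := (√(2 * Real.pi * ((1 : NNReal) : ℝ)))⁻¹ with hc
    have hc0 : 0 < c := by positivity
    have hcc : c = c ^ s * c ^ (1 - s) := by
      rw [← Real.rpow_add hc0]; simp
    rw [Real.mul_rpow hc0.le (Real.exp_pos _).le, Real.mul_rpow hc0.le (Real.exp_pos _).le,
      ← Real.exp_mul, ← Real.exp_mul]
    have e : ∀ p q a b d : ℝ, p * a * (q * b) * d = p * q * (a * b * d) := by intros; ring
    rw [e, ← hcc, ← Real.exp_add, ← Real.exp_add]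
    congr 2
    simp
    ring
  have main := lintegral_rpow_mul_lintegral_rpow_le_of_quasiconcave hs hs1
    (F := fun x => f x * gaussianPDF 0 1 x) (G := fun x => g x * gaussianPDF 0 1 x)
    (H := fun x => K * gaussianPDF 0 1 x) (hf.mul hφ) (hg.mul hφ) (hφ.const_mul K)
    (M := K * gaussianPDF 0 1 0) (ENNReal.mul_ne_top hK ENNReal.ofReal_ne_top)
    (fun x => mul_le_mul_right (gaussianPDF_le_of_sq_le (by simpa using sq_nonneg x)) _)
    (convex_setOf_le_const_mul_gaussianPDF K)
    (fun x y => by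
      rw [ENNReal.mul_rpow_of_nonneg _ _ hs.le, ENNReal.mul_rpow_of_nonneg _ _ hs2.le,
        mul_mul_mul_comm, ← hφ_mul]
      calc _ ≤ K * ENNReal.ofReal (Real.exp (s * (1 - s) * (x - y) ^ 2 / 2)) *
            (gaussianPDF 0 1 x ^ s * gaussianPDF 0 1 y ^ (1 - s)) := mul_le_mul_left (h x y) _
        _ = _ := by ring)
  rw [lintegral_const_mul _ hφ, lintegral_gaussianPDF_eq_one 0 one_ne_zero, mul_one] at main
  rw [gaussianReal_of_var_ne_zero 0 one_ne_zero,
    lintegral_withDensity_eq_lintegral_mul _ hφ hf, lintegral_withDensity_eq_lintegral_mul _ hφ hg]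
  simpa only [Pi.mul_apply, mul_comm] using main

lemma TwoFunctionInequality.prod {α β : Type*} [MeasurableSpace α] [MeasurableSpace β]
    {μ : Measure α} {ν : Measure β} [SFinite μ] [SFinite ν] {s : ℝ} {C : α → α → ℝ≥0∞}
    {D : β → β → ℝ≥0∞} (hμ : TwoFunctionInequality μ s C) (hν : TwoFunctionInequality ν s D) :
    TwoFunctionInequality (μ.prod ν) s fun x y => C x.1 y.1 * D x.2 y.2 := by
  intro K f g hf hg h
  rw [lintegral_prod _ hf.aemeasurable, lintegral_prod _ hg.aemeasurable]
  refine hμ K _ _ hf.lintegral_prod_right' hg.lintegral_prod_right' fun x y => ?_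
  refine hν _ _ _ (by fun_prop) (by fun_prop) fun x' y' => ?_
  simpa only [mul_assoc] using h (x, x') (y, y')

lemma TwoFunctionInequality.map {α β : Type*} [MeasurableSpace α] [MeasurableSpace β]
    {μ : Measure α} {s : ℝ} {C : α → α → ℝ≥0∞} {D : β → β → ℝ≥0∞} {φ : α → β}
    (hφ : Measurable φ) (hμ : TwoFunctionInequality μ s C)
    (hCD : ∀ x y, D (φ x) (φ y) ≤ C x y) : TwoFunctionInequality (μ.map φ) s D := by
  intro K f g hf hg h
  rw [lintegral_map hf hφ, lintegral_map hg hφ]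
  refine hμ K _ _ (hf.comp hφ) (hg.comp hφ) fun x y => (h _ _).trans ?_
  gcongr
  exact hCD x y

lemma twoFunctionInequality_pi_gaussianReal {s : ℝ} (hs : 0 < s) (hs1 : s < 1) (n : ℕ) :
    TwoFunctionInequality (Measure.pi fun _ : Fin n => gaussianReal 0 1) s
      fun x y => ENNReal.ofReal (Real.exp (s * (1 - s) * (∑ i, (x i - y i) ^ 2) / 2)) := by
  induction n with
  | zero =>
    intro K f g hf hg h
    rw [Measure.pi_of_empty _ isEmptyElim, lintegral_dirac' _ hf, lintegral_dirac' _ hg]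
    simpa using h isEmptyElim isEmptyElim
  | succ n ih =>
    have hmp := (measurePreserving_piFinSuccAbove (fun _ : Fin (n + 1) => gaussianReal 0 1) 0).symm
    rw [← hmp.map_eq]
    refine ((twoFunctionInequality_gaussianReal hs hs1).prod ih).map hmp.measurable fun x y => ?_
    rw [← ENNReal.ofReal_mul (Real.exp_pos _).le, ← Real.exp_add]
    refine le_of_eq ?_
    congr 2
    simp [Fin.sum_univ_succ]
    ring

lemma twoFunctionInequality_stdGaussian {E : Type*} [NormedAddCommGroup E] [InnerProductSpace ℝ E]
    [FiniteDimensional ℝ E] [MeasurableSpace E] [BorelSpace E] {s : ℝ} (hs : 0 < s) (hs1 : s < 1) :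
    TwoFunctionInequality (stdGaussian E) s
      fun x y => ENNReal.ofReal (Real.exp (s * (1 - s) * ‖x - y‖ ^ 2 / 2)) := by
  refine (twoFunctionInequality_pi_gaussianReal hs hs1 _).map (by fun_prop) fun x y => ?_
  refine le_of_eq ?_
  congr 4
  rw [← Finset.sum_sub_distrib]
  simp_rw [← sub_smul]
  rw [← real_inner_self_eq_norm_sq, (stdOrthonormalBasis ℝ E).orthonormal.inner_sum]
  simp [sq]

/-- Dimension-free concentration: two sets at distance at least `d` cannot both have large
Gaussian measure. -/
lemma stdGaussian_rpow_mul_rpow_le {E : Type*} [NormedAddCommGroup E] [InnerProductSpace ℝ E]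
    [FiniteDimensional ℝ E] [MeasurableSpace E] [BorelSpace E] {s : ℝ} (hs : 0 < s) (hs1 : s < 1)
    {A B : Set E} (hA : MeasurableSet A) (hB : MeasurableSet B) {d : ℝ} (hd : 0 ≤ d)
    (hAB : ∀ x ∈ A, ∀ y ∈ B, d ≤ ‖x - y‖) :
    stdGaussian E A ^ s * stdGaussian E B ^ (1 - s) ≤
      ENNReal.ofReal (Real.exp (-(s * (1 - s) * d ^ 2 / 2))) := by
  have hs2 : 0 < 1 - s := by linarith
  have h := twoFunctionInequality_stdGaussian (E := E) hs hs1
    (ENNReal.ofReal (Real.exp (-(s * (1 - s) * d ^ 2 / 2)))) (A.indicator 1) (B.indicator 1)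
    (measurable_one.indicator hA) (measurable_one.indicator hB) fun x y => by
      by_cases hx : x ∈ A
      · by_cases hy : y ∈ B
        · have hxy := hAB x hx y hy
          have : s * (1 - s) * d ^ 2 ≤ s * (1 - s) * ‖x - y‖ ^ 2 := by gcongr
          rw [← ENNReal.ofReal_mul (Real.exp_pos _).le, ← Real.exp_add]
          simp only [hx, hy, Set.indicator_of_mem, Pi.one_apply, ENNReal.one_rpow, mul_one]
          rw [← ENNReal.ofReal_one]
          refine ENNReal.ofReal_le_ofReal (Real.one_le_exp ?_)
          linarith
        · simp [hy, hs1]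
      · simp [hx, hs]
  rwa [lintegral_indicator_one hA, lintegral_indicator_one hB] at h

/-! ### Tail of the supremum of a Gaussian family -/

section FiniteFamily

variable {Ω ι : Type*} [MeasurableSpace Ω] {P : Measure Ω} [IsProbabilityMeasure P] [Fintype ι]
  {Y : ι → Ω → ℝ}

open scoped MatrixOrder in
/-- A centered Gaussian vector is a linear image of a standard one, and the variances of its
coordinates are the squared norms of the rows of the linear map. -/
lemma ProbabilityTheory.HasGaussianLaw.exists_map_eq_map_stdGaussian
    (hY : HasGaussianLaw (fun ω i => Y i ω) P) (hY0 : ∀ i, ∫ ω, Y i ω ∂P = 0) :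
    ∃ L : EuclideanSpace ℝ ι →L[ℝ] EuclideanSpace ℝ ι,
      P.map (fun ω => WithLp.toLp 2 fun i => Y i ω) =
        (stdGaussian (EuclideanSpace ℝ ι)).map L ∧
      ∀ i, ‖(EuclideanSpace.proj (𝕜 := ℝ) i).comp L‖ ^ 2 = Var[Y i; P] := by
  classical
  have hL2 : ∀ i, MemLp (Y i) 2 P := fun i => (hY.eval i).memLp_two
  set ν := P.map (fun ω => WithLp.toLp 2 fun i => Y i ω) with hν
  have hZ : HasGaussianLaw (fun ω => WithLp.toLp 2 fun i => Y i ω) P := hY.toLp_pi 2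
  have : IsGaussian ν := hZ.isGaussian_map
  set S : Matrix ι ι ℝ := Matrix.of fun i j => cov[Y i, Y j; P] with hS_def
  have hcov : ∀ x y, covarianceBilin ν x y = x ⬝ᵥ S.mulVec y := by
    intro x y
    rw [hν, covarianceBilin_apply_pi hL2]
    simp only [dotProduct, Matrix.mulVec, Finset.mul_sum, hS_def, Matrix.of_apply]
    exact Finset.sum_congr rfl fun i _ => Finset.sum_congr rfl fun j _ => by ring
  have hS : S.PosSemidef := by
    refine Matrix.PosSemidef.of_dotProduct_mulVec_nonneg ?_ fun x => ?_
    · ext i j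
      simp [hS_def, covariance_comm]
    · have := covarianceBilin_self_nonneg (μ := ν) (WithLp.toLp 2 x)
      rw [hcov] at this
      simpa using this
  have hlaw : ν = multivariateGaussian 0 S := by
    refine IsGaussian.ext ?_ ?_
    · rw [integral_id_multivariateGaussian', hν, integral_map hZ.aemeasurable (by fun_prop)]
      ext i
      have := (EuclideanSpace.proj (𝕜 := ℝ) i).integral_comp_comm hZ.integrable
      simpa [hY0 i] using this.symm
    · ext x y
      rw [hcov, covarianceBilin_multivariateGaussian hS]
  refine ⟨Matrix.toEuclideanCLM (𝕜 := ℝ) (CFC.sqrt S), ?_, fun i => ?_⟩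
  · rw [hlaw, multivariateGaussian]
    simp
  · rw [← variance_dual_stdGaussian]
    have h := variance_eval_multivariateGaussian (μ := (0 : EuclideanSpace ℝ ι)) hS i
    rw [multivariateGaussian, variance_map (by fun_prop) (by fun_prop)] at h
    rw [← covariance_self (hL2 i).aemeasurable]
    refine Eq.trans ?_ h
    congr 1
    ext x
    simp

lemma ProbabilityTheory.HasGaussianLaw.measure_le_rpow_mul_measure_lt_rpow_le
    (hY : HasGaussianLaw (fun ω i => Y i ω) P) (hY0 : ∀ i, ∫ ω, Y i ω ∂P = 0)
    {v : ℝ} (hv : 0 < v) (hYv : ∀ i, Var[Y i; P] ≤ v) {s : ℝ} (hs : 0 < s) (hs1 : s < 1)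
    (m : ℝ) {d : ℝ} (hd : 0 ≤ d) :
    P {ω | ∀ i, Y i ω ≤ m} ^ s * P {ω | ∃ i, m + d < Y i ω} ^ (1 - s) ≤
      ENNReal.ofReal (Real.exp (-(s * (1 - s) * (d ^ 2 / v) / 2))) := by
  obtain ⟨L, hL, hL_norm⟩ := hY.exists_map_eq_map_stdGaussian hY0
  have hZ : HasGaussianLaw (fun ω => WithLp.toLp 2 fun i => Y i ω) P := hY.toLp_pi 2
  have hA : MeasurableSet {x : EuclideanSpace ℝ ι | ∀ i, x i ≤ m} := by
    have : {x : EuclideanSpace ℝ ι | ∀ i, x i ≤ m} = ⋂ i, {x | x i ≤ m} := by ext; simp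
    rw [this]
    exact MeasurableSet.iInter fun i => measurableSet_le (by fun_prop) (by fun_prop)
  have hB : MeasurableSet {x : EuclideanSpace ℝ ι | ∃ i, m + d < x i} := by
    have : {x : EuclideanSpace ℝ ι | ∃ i, m + d < x i} = ⋃ i, {x | m + d < x i} := by ext; simp
    rw [this]
    exact MeasurableSet.iUnion fun i => measurableSet_lt (by fun_prop) (by fun_prop)
  have hPA := Measure.map_apply_of_aemeasurable hZ.aemeasurable hA
  have hPB := Measure.map_apply_of_aemeasurable hZ.aemeasurable hB
  rw [hL, Measure.map_apply L.measurable hA] at hPA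
  rw [hL, Measure.map_apply L.measurable hB] at hPB
  have h := stdGaussian_rpow_mul_rpow_le hs hs1 (L.measurable hA) (L.measurable hB)
    (d := d / √v) (by positivity) fun x hx y hy => by
      obtain ⟨i, hi⟩ := hy
      have hxi : (L x) i ≤ m := hx i
      have h1 : (L y) i - (L x) i ≤ √v * ‖x - y‖ := by
        have hop := ((EuclideanSpace.proj (𝕜 := ℝ) i).comp L).le_opNorm (y - x)
        have hnorm : ‖(EuclideanSpace.proj (𝕜 := ℝ) i).comp L‖ ≤ √v :=
          Real.le_sqrt_of_sq_le ((hL_norm i).trans_le (hYv i))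
        rw [norm_sub_rev x y]
        calc (L y) i - (L x) i ≤ ‖(EuclideanSpace.proj (𝕜 := ℝ) i).comp L (y - x)‖ := by
              refine le_trans (le_of_eq ?_) (Real.le_norm_self _)
              simp
          _ ≤ _ := hop.trans (by gcongr)
      rw [div_le_iff₀' (Real.sqrt_pos.2 hv)]
      linarith
  rw [hPA, hPB, div_pow, Real.sq_sqrt hv.le] at h
  exact h

/-- Upper tail of the maximum of a centered Gaussian vector, with the sharp constant in the
exponent at the price of a shift by `3 √v`. -/
lemma ProbabilityTheory.HasGaussianLaw.measure_exists_lt_le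
    (hY : HasGaussianLaw (fun ω i => Y i ω) P) (hY0 : ∀ i, ∫ ω, Y i ω ∂P = 0)
    {v : ℝ} (hv : 0 < v) (hYv : ∀ i, Var[Y i; P] ≤ v) {m : ℝ}
    (hm : 1 / 2 ≤ P {ω | ∀ i, Y i ω ≤ m}) {u : ℝ} (hu : m + 3 * √v < u) :
    P {ω | ∃ i, u < Y i ω} ≤
      ENNReal.ofReal (Real.exp (-((u - (m + 3 * √v)) ^ 2 / (2 * v)))) := by
  obtain ⟨d, rfl⟩ : ∃ d, u = m + d := ⟨u - m, by ring⟩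
  obtain ⟨a, ha⟩ : ∃ a, a = 3 * √v := ⟨_, rfl⟩
  rw [← ha] at hu ⊢
  have hv2 : a ^ 2 = 9 * v := by rw [ha, mul_pow, Real.sq_sqrt hv.le]; norm_num
  have ha0 : 0 < a := by rw [ha]; positivity
  have had : a < d := by linarith
  have hd : 0 < d := ha0.trans had
  -- A weight `ε` of order `1 / d` on the tail event costs only `O(d)` in the exponent, which the
  -- shift by `a` absorbs.
  obtain ⟨ε, hε⟩ : ∃ ε, ε = a / (2 * d) := ⟨_, rfl⟩
  have hε0 : 0 < ε := by rw [hε]; positivity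
  have hε1 : ε < 1 := by rw [hε, div_lt_one (by positivity)]; linarith
  have h := hY.measure_le_rpow_mul_measure_lt_rpow_le hY0 hv hYv (s := 1 - ε) (by linarith)
    (by linarith) m hd.le
  rw [sub_sub_cancel] at h
  set b := P {ω | ∃ i, m + d < Y i ω} with hb
  have hhalf : ENNReal.ofReal (Real.exp (-Real.log 2)) ≤
      P {ω | ∀ i, Y i ω ≤ m} ^ (1 - ε) := by
    have e1 : ENNReal.ofReal (Real.exp (-Real.log 2)) = 1 / 2 := by
      rw [Real.exp_neg, Real.exp_log two_pos, ENNReal.ofReal_inv_of_pos two_pos]; simp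
    rw [e1]
    calc (1 / 2 : ℝ≥0∞) = (1 / 2) ^ (1 : ℝ) := by simp
      _ ≤ (1 / 2) ^ (1 - ε) :=
        ENNReal.rpow_le_rpow_of_exponent_ge (by simp) (by linarith)
      _ ≤ _ := by gcongr
  have h1 : ENNReal.ofReal (Real.exp (-Real.log 2)) * b ^ ε ≤
      ENNReal.ofReal (Real.exp (-((1 - ε) * ε * (d ^ 2 / v) / 2))) :=
    (mul_le_mul_left hhalf _).trans h
  have h2 : b ^ ε ≤
      ENNReal.ofReal (Real.exp (Real.log 2 - (1 - ε) * ε * (d ^ 2 / v) / 2)) := by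
    calc b ^ ε = ENNReal.ofReal (Real.exp (Real.log 2)) *
          (ENNReal.ofReal (Real.exp (-Real.log 2)) * b ^ ε) := by
          rw [← mul_assoc, ← ENNReal.ofReal_mul (Real.exp_pos _).le, ← Real.exp_add]; simp
      _ ≤ ENNReal.ofReal (Real.exp (Real.log 2)) *
          ENNReal.ofReal (Real.exp (-((1 - ε) * ε * (d ^ 2 / v) / 2))) := by gcongr
      _ = _ := by
          rw [← ENNReal.ofReal_mul (Real.exp_pos _).le, ← Real.exp_add, ← sub_eq_add_neg]
  have h3 : Real.log 2 - (1 - ε) * ε * (d ^ 2 / v) / 2 ≤ -((m + d - (m + a)) ^ 2 / (2 * v)) * ε := by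
    have hεd : ε * d = a / 2 := by rw [hε]; field_simp
    have e1 : (1 - ε) * ε * (d ^ 2 / v) / 2 = (a * d / 2 - a ^ 2 / 4) / (2 * v) := by
      have : (1 - ε) * ε * d ^ 2 = a * d / 2 - a ^ 2 / 4 := by
        calc (1 - ε) * ε * d ^ 2 = (ε * d) * d - (ε * d) ^ 2 := by ring
          _ = _ := by rw [hεd]; ring
      rw [← this]; field_simp
    have e2 : -((m + d - (m + a)) ^ 2 / (2 * v)) * ε =
        -(a * d / 2 - a ^ 2 + ε * a ^ 2) / (2 * v) := by
      have : ε * (d - a) ^ 2 = a * d / 2 - a ^ 2 + ε * a ^ 2 := by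
        calc ε * (d - a) ^ 2 = (ε * d) * d - 2 * a * (ε * d) + ε * a ^ 2 := by ring
          _ = _ := by rw [hεd]; ring
      rw [← this]; ring
    have hε2 : ε < 1 / 2 := by rw [hε, div_lt_iff₀ (by positivity)]; linarith
    rw [e1, e2, ← sub_nonneg]
    have e3 : -(a * d / 2 - a ^ 2 + ε * a ^ 2) / (2 * v) -
        (Real.log 2 - (a * d / 2 - a ^ 2 / 4) / (2 * v)) =
          (a ^ 2 * (3 / 4 - ε)) / (2 * v) - Real.log 2 := by ring
    -- Since `ε < 1 / 2`, it is enough that `a ^ 2 = 9 v` exceeds `8 v log 2`.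
    rw [e3, hv2, sub_nonneg, le_div_iff₀ (by positivity)]
    nlinarith [Real.log_two_lt_d9, mul_pos hv (sub_pos.2 hε2), mul_pos hv (sub_pos.2 Real.log_two_lt_d9)]
  calc b = (b ^ ε) ^ ε⁻¹ := by
        rw [← ENNReal.rpow_mul, mul_inv_cancel₀ hε0.ne', ENNReal.rpow_one]
    _ ≤ (ENNReal.ofReal (Real.exp (-((m + d - (m + a)) ^ 2 / (2 * v)) * ε))) ^ ε⁻¹ := by
        gcongr
        exact h2.trans (ENNReal.ofReal_le_ofReal (Real.exp_le_exp.2 h3))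
    _ = _ := by
        rw [ENNReal.ofReal_rpow_of_pos (Real.exp_pos _), ← Real.exp_mul, mul_assoc,
          mul_inv_cancel₀ hε0.ne', mul_one]

end FiniteFamily

/-- A form of the Borell–TIS inequality for countable index sets: the supremum of an almost surely
bounded centered Gaussian family with variances at most `v` has the tail of a centered Gaussian
variable of variance `v`, up to a shift. -/
lemma ProbabilityTheory.IsGaussianProcess.exists_forall_measure_exists_lt_le {Ω D : Type*}
    [MeasurableSpace Ω] {P : Measure Ω} [IsProbabilityMeasure P] [Countable D] {Y : D → Ω → ℝ}
    (hY : IsGaussianProcess Y P) (hY0 : ∀ t, ∫ ω, Y t ω ∂P = 0) {v : ℝ} (hv : 0 < v)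
    (hYv : ∀ t, Var[Y t; P] ≤ v)
    (hbdd : ∀ᵐ ω ∂P, BddAbove (Set.range fun t => Y t ω)) :
    ∃ μ : ℝ, 0 < μ ∧ ∀ u, μ < u →
      P {ω | ∃ t, u < Y t ω} ≤ ENNReal.ofReal (Real.exp (-((u - μ) ^ 2 / (2 * v)))) := by
  obtain ⟨m, hm⟩ : ∃ m : ℕ, 1 / 2 < P {ω | ∀ t, Y t ω ≤ m} := by
    have hmono : Monotone fun m : ℕ => {ω | ∀ t, Y t ω ≤ m} := fun m m' hmm ω hω t =>
      (hω t).trans (by exact_mod_cast hmm)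
    have hlim := tendsto_measure_iUnion_atTop (μ := P) hmono
    have hone : P (⋃ m : ℕ, {ω | ∀ t, Y t ω ≤ m}) = 1 := by
      rw [← measure_univ (μ := P)]
      refine measure_congr (Filter.eventuallyEq_univ.2 ?_)
      filter_upwards [hbdd] with ω ⟨c, hc⟩
      obtain ⟨m, hm⟩ := exists_nat_ge c
      exact Set.mem_iUnion.2 ⟨m, fun t => (hc ⟨t, rfl⟩).trans hm⟩
    rw [hone] at hlim
    exact (hlim.eventually_const_lt (by simp : (1 / 2 : ℝ≥0∞) < 1)).exists
  refine ⟨m + 3 * √v, by positivity, fun u hu => ?_⟩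
  have hU : {ω | ∃ t, u < Y t ω} = ⋃ I : Finset D, {ω | ∃ t : I, u < Y t ω} := by
    ext ω
    simp only [Set.mem_ofPred_eq, Set.mem_iUnion]
    exact ⟨fun ⟨t, ht⟩ => ⟨{t}, ⟨t, by simp⟩, ht⟩, fun ⟨_, t, ht⟩ => ⟨t, ht⟩⟩
  have hdir : Directed (· ⊆ ·) fun I : Finset D => {ω | ∃ t : I, u < Y t ω} :=
    directed_of_isDirected_le fun I J hIJ ω ⟨t, ht⟩ => ⟨⟨t, Finset.mem_of_subset hIJ t.2⟩, ht⟩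
  rw [hU, hdir.measure_iUnion]
  refine iSup_le fun I => ?_
  exact (hY.hasGaussianLaw I).measure_exists_lt_le (Y := fun (t : I) => Y t) (fun t => hY0 t) hv
    (fun t => hYv t) (hm.le.trans (measure_mono fun ω hω t => hω t)) hu

/-! ### Convex combinations of the coordinates -/

/-- Convex weights minimizing `∑ i, w i ^ 2 * σ i`: they are proportional to `1 / σ i`, or
concentrated on an index at which `σ` vanishes, and the minimum is `(∑ i, 1 / σ i)⁻¹`. -/
lemma exists_weights_sum_sq_mul_le {ι : Type*} [Fintype ι] {σ : ι → ℝ} (hσ : ∀ i, 0 ≤ σ i)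
    {τ : ℝ≥0∞} (hτ : 0 < τ) (hτσ : τ ≤ ∑ i, (ENNReal.ofReal (σ i))⁻¹) :
    ∃ w : ι → ℝ, (∀ i, 0 ≤ w i) ∧ ∑ i, w i = 1 ∧ ∑ i, w i ^ 2 * σ i ≤ (τ⁻¹).toReal := by
  classical
  by_cases h0 : ∃ i, σ i = 0
  · obtain ⟨i, hi⟩ := h0
    refine ⟨Pi.single i 1, fun j => ?_, by simp, ?_⟩
    · by_cases h : j = i
      · subst h; simp
      · simp [h]
    · rw [Finset.sum_eq_single i]
      · simp [hi]
      · intro j _ hj; simp [hj]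
      · simp
  · push Not at h0
    have hpos : ∀ i, 0 < σ i := fun i => lt_of_le_of_ne (hσ i) (h0 i).symm
    set S := ∑ i, (σ i)⁻¹ with hS
    have hsum : ∑ i, (ENNReal.ofReal (σ i))⁻¹ = ENNReal.ofReal S := by
      rw [hS, ENNReal.ofReal_sum_of_nonneg fun i _ => (inv_pos.2 (hpos i)).le]
      exact Finset.sum_congr rfl fun i _ => (ENNReal.ofReal_inv_of_pos (hpos i)).symm
    rw [hsum] at hτσ
    have hS0 : 0 < S := ENNReal.ofReal_pos.1 (hτ.trans_le hτσ)
    refine ⟨fun i => (σ i)⁻¹ / S, fun i => div_nonneg (inv_nonneg.2 (hσ i)) hS0.le, ?_, ?_⟩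
    · rw [← Finset.sum_div, div_self hS0.ne']
    · have e : ∀ i, ((σ i)⁻¹ / S) ^ 2 * σ i = (σ i)⁻¹ / S ^ 2 := fun i => by
        have := h0 i
        field_simp
      simp_rw [e]
      rw [← Finset.sum_div, ← hS]
      calc S / S ^ 2 = ((ENNReal.ofReal S)⁻¹).toReal := by
            rw [ENNReal.toReal_inv, ENNReal.toReal_ofReal hS0.le]; field_simp
        _ ≤ (τ⁻¹).toReal := by
            refine ENNReal.toReal_mono (ENNReal.inv_ne_top.2 hτ.ne') ?_
            exact ENNReal.inv_le_inv.2 hτσ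

namespace IsCenteredVectorGaussianProcess

variable {Ω T : Type*} [MeasurableSpace Ω] [TopologicalSpace T] {n : ℕ} {X : T → Ω → Fin n → ℝ}
  {P : Measure Ω}

lemma isGaussianProcess_sum_mul (hX : IsCenteredVectorGaussianProcess X P) (w : T → Fin n → ℝ) :
    IsGaussianProcess (fun t ω => ∑ i, w t i * X t ω i) P where
  hasGaussianLaw J := by
    have hind : iIndepFun (fun (i : Fin n) (ω : Ω) => J.restrict fun t => X t ω i) P :=
      hX.iIndepFun_coord.comp (fun _ => J.restrict) fun _ => Finset.measurable_restrict J
    have h := hind.hasGaussianLaw fun i => (hX.isGaussianProcess i).hasGaussianLaw J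
    let L : (Fin n → J → ℝ) →L[ℝ] (J → ℝ) := ContinuousLinearMap.pi fun t =>
      ∑ i, w t i • (ContinuousLinearMap.proj (R := ℝ) (φ := fun _ : J => ℝ) t).comp
        (ContinuousLinearMap.proj (R := ℝ) (φ := fun _ : Fin n => J → ℝ) i)
    have hL : (fun ω => J.restrict fun t => ∑ i, w t i * X t ω i) =
        fun ω => L fun i => J.restrict fun t => X t ω i := by
      ext ω t
      simp [L]
    exact hL ▸ h.map_fun L

lemma memLp_two (hX : IsCenteredVectorGaussianProcess X P) (t : T) (i : Fin n) :
    MemLp (fun ω => X t ω i) 2 P :=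
  ((hX.isGaussianProcess i).hasGaussianLaw_eval t).memLp_two

lemma integral_sum_mul (hX : IsCenteredVectorGaussianProcess X P) (t : T) (w : Fin n → ℝ) :
    ∫ ω, ∑ i, w i * X t ω i ∂P = 0 := by
  rw [integral_finsetSum]
  · simp [integral_const_mul, hX.centered]
  · exact fun i _ => ((hX.isGaussianProcess i).hasGaussianLaw_eval t).integrable.const_mul _

lemma variance_sum_mul (hX : IsCenteredVectorGaussianProcess X P) (t : T) (w : Fin n → ℝ) :
    Var[fun ω => ∑ i, w i * X t ω i; P] = ∑ i, w i ^ 2 * Var[fun ω => X t ω i; P] := by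
  have hind : iIndepFun (fun (i : Fin n) (ω : Ω) => w i * X t ω i) P :=
    hX.iIndepFun_coord.comp (fun i x => w i * x t) fun i => by fun_prop
  have h := IndepFun.variance_sum (μ := P) (s := Finset.univ)
    (X := fun (i : Fin n) (ω : Ω) => w i * X t ω i)
    (fun i _ => (hX.memLp_two t i).const_mul _) fun i _ j _ hij => hind.indepFun hij
  simp_rw [variance_const_mul] at h
  rw [← h]
  congr 1
  ext ω
  simp

lemma ae_bddAbove_range_sum_mul [CompactSpace T] (hX : IsCenteredVectorGaussianProcess X P)
    {w : T → Fin n → ℝ} (hw0 : ∀ t i, 0 ≤ w t i) (hw1 : ∀ t, ∑ i, w t i = 1) :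
    ∀ᵐ ω ∂P, BddAbove (Set.range fun t => ∑ i, w t i * X t ω i) := by
  filter_upwards [ae_all_iff.2 hX.continuous_paths] with ω hω
  choose c hc using fun i => (isCompact_range (hω i)).bddAbove
  refine ⟨∑ i, |c i|, ?_⟩
  rintro _ ⟨t, rfl⟩
  refine Finset.sum_le_sum fun i _ => ?_
  have hwi : w t i ≤ 1 := hw1 t ▸ Finset.single_le_sum (fun j _ => hw0 t j) (Finset.mem_univ i)
  calc w t i * X t ω i ≤ w t i * |c i| :=
        mul_le_mul_of_nonneg_left ((hc i ⟨t, rfl⟩).trans (le_abs_self _)) (hw0 t i)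
    _ ≤ |c i| := mul_le_of_le_one_left (abs_nonneg _) hwi

/-- Joint exceedance of a level forces every convex combination of the coordinates to exceed it. By
path continuity this may be tested on a dense set; no continuity of the weights is needed. -/
lemma measure_exists_forall_lt_le (hX : IsCenteredVectorGaussianProcess X P) {D : Set T}
    (hD : Dense D) {w : T → Fin n → ℝ} (hw0 : ∀ t i, 0 ≤ w t i) (hw1 : ∀ t, ∑ i, w t i = 1)
    (u : ℝ) :
    P {ω | ∃ t, ∀ i, u < X t ω i} ≤ P {ω | ∃ t : D, u < ∑ i, w t i * X t ω i} := by
  refine measure_mono_ae ?_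
  filter_upwards [ae_all_iff.2 hX.continuous_paths] with ω hω
  rintro ⟨t₀, ht₀⟩
  have hopen : IsOpen {t | ∀ i, u < X t ω i} := by
    simp only [Set.ofPred_forall]
    exact isOpen_iInter_of_finite fun i => isOpen_lt continuous_const (hω i)
  obtain ⟨t, htX, htD⟩ := hD.inter_open_nonempty _ hopen ⟨t₀, ht₀⟩
  refine ⟨⟨t, htD⟩, ?_⟩
  obtain ⟨i, hi⟩ : ∃ i, w t i ≠ 0 := by
    by_contra! h
    simpa [h] using hw1 t
  calc u = ∑ i, w t i * u := by rw [← Finset.sum_mul, hw1, one_mul]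
    _ < ∑ i, w t i * X t ω i :=
      Finset.sum_lt_sum (fun j _ => mul_le_mul_of_nonneg_left (htX j).le (hw0 t j))
        ⟨i, Finset.mem_univ i, mul_lt_mul_of_pos_left (htX i) ((hw0 t i).lt_of_ne' hi)⟩

end IsCenteredVectorGaussianProcess

theorem lemma5p2 {k n : ℕ} (T : Set (EuclideanSpace ℝ (Fin k))) (hT : IsCompact T)
    {Ω : Type*} [MeasurableSpace Ω] (P : Measure Ω) [IsProbabilityMeasure P]
    (X : T → Ω → Fin n → ℝ) (hX : IsCenteredVectorGaussianProcess X P)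
    (hτ : 0 < tauSq X P) :
    ∃ μ : ℝ, 0 < μ ∧ ∀ u : ℝ, μ < u →
      P {ω | ∃ t : T, ∀ i : Fin n, u < X t ω i} ≤
        EReal.exp (-((((u - μ) ^ 2 / 2 : ℝ) : EReal) * ((tauSq X P : ℝ≥0∞) : EReal))) := by
  have : CompactSpace T := isCompact_iff_compactSpace.1 hT
  obtain ⟨D, hD_count, hD⟩ := TopologicalSpace.exists_countable_dense T
  have : Countable D := hD_count.to_subtype
  choose w hw0 hw1 hwv using fun t : T => exists_weights_sum_sq_mul_le
    (fun i => variance_nonneg (fun ω => X t ω i) P) hτ (iInf_le _ t)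
  have hYv : ∀ t, Var[fun ω => ∑ i, w t i * X t ω i; P] ≤ ((tauSq X P)⁻¹).toReal := fun t => by
    rw [hX.variance_sum_mul t]; exact hwv t
  have hcomp := hX.measure_exists_forall_lt_le hD hw0 hw1
  rcases eq_or_ne (tauSq X P) ∞ with htop | htop
  · -- Every convex combination has variance `0`, hence vanishes almost surely.
    refine ⟨1, one_pos, fun u hu => (hcomp u).trans ?_⟩
    have hzero : ∀ᵐ ω ∂P, ∀ t : D, ∑ i, w t i * X t ω i = 0 := by
      refine ae_all_iff.2 fun t => ?_
      have hV : Var[fun ω => ∑ i, w t i * X t ω i; P] = 0 :=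
        le_antisymm (by simpa [htop] using hYv t) (variance_nonneg _ _)
      have hmem : MemLp (fun ω => ∑ i, w t i * X t ω i) 2 P :=
        memLp_finsetSum _ fun i _ => (hX.memLp_two t i).const_mul _
      have heV : eVar[fun ω => ∑ i, w t i * X t ω i; P] = 0 := by
        rw [← ofReal_variance hmem, hV, ENNReal.ofReal_zero]
      filter_upwards [(evariance_eq_zero_iff hmem.aestronglyMeasurable.aemeasurable).1 heV] with ω hω
      rw [hω, hX.integral_sum_mul]
    have hnull : P {ω | ∃ t : D, u < ∑ i, w t i * X t ω i} = 0 := by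
      refine measure_eq_zero_iff_ae_notMem.2 ?_
      filter_upwards [hzero] with ω hω
      rintro ⟨t, ht⟩
      rw [hω t] at ht
      linarith
    rw [hnull]
    exact zero_le
  · obtain ⟨r, hr⟩ : ∃ r : ℝ, tauSq X P = ENNReal.ofReal r :=
      ⟨_, (ENNReal.ofReal_toReal htop).symm⟩
    have hr0 : 0 < r := ENNReal.ofReal_pos.1 (hr ▸ hτ)
    have hv : ((tauSq X P)⁻¹).toReal = r⁻¹ := by
      rw [hr, ENNReal.toReal_inv, ENNReal.toReal_ofReal hr0.le]
    obtain ⟨μ, hμ, h⟩ := ((hX.isGaussianProcess_sum_mul w).restrict D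
      ).exists_forall_measure_exists_lt_le
      (fun t => hX.integral_sum_mul t (w t)) (inv_pos.2 hr0) (fun t => hv ▸ hYv t)
      (by
        filter_upwards [hX.ae_bddAbove_range_sum_mul hw0 hw1] with ω hω
        refine hω.mono ?_
        rintro _ ⟨t, rfl⟩
        exact ⟨t, rfl⟩)
    refine ⟨μ, hμ, fun u hu => (hcomp u).trans ((h u hu).trans (le_of_eq ?_))⟩
    rw [hr, EReal.coe_ennreal_ofReal, max_eq_left hr0.le, ← EReal.coe_mul, ← EReal.coe_neg,
      EReal.exp_coe]
    congr 3
    field_simp
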